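/- Let the $5\times n$ grid graph have vertex set $\{0,\dots,n-1\}\times\{0,\dots,4\}$, with an edge between any two points at distance $1$. A growing self-avoiding walk (GSAW) on a graph is a directed walk that visits no vertex twice and whose endpoint is trapped, i.e. every neighbour of the endpoint has been visited. A Greek key tour on the $5\times n$ grid graph is a GSAW that starts in the upper-left corner $(0,4)$ and visits every vertex. Let $g_{5,n}$ be the number of Greek key tours on the $5\times n$ grid graph, with the convention $g_{5,0}=1$ (the empty tour of the empty grid), and let $G_5(x)=\sum_{n\ge 0} g_{5,n}x^n$ as a formal power series. Then $$G_5(x)=\frac{1-3x-13x^2+58x^3+25x^4-162x^5+63x^6+113x^7-61x^8+12x^9-11x^{10}+25x^{11}-17x^{12}+5x^{13}-3x^{14}}{(1+x)(1-11x^2-2x^6)(1-5x+2x^2+8x^3-8x^4+x^5-x^6)}$$ $$=1+x+5x^2+38x^3+160x^4+824x^5+\cdots.$$ Consequently (confirming Barker's conjecture on OEIS A145156), $a(n)=g_{5,n}$ satisfies, for all $n\ge 15$, $$a(n)=4a(n-1)+14a(n-2)-54a(n-3)-33a(n-4)+117a(n-5)+2a(n-6)-84a(n-7)-6a(n-8)+9a(n-9)-14a(n-11)-2a(n-13).$$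 -/

import Mathlib

/-- The grid graph on a set `S` of integer points of the plane: two points are adjacent exactly
when their Euclidean distance is `1`. -/
def gridGraph (S : Set (ℤ × ℤ)) : SimpleGraph S where
  Adj p q := (p.1.1 - q.1.1) ^ 2 + (p.1.2 - q.1.2) ^ 2 = 1
  symm := ⟨fun p q h => by
    rw [← h]
    ring⟩
  loopless := ⟨fun p h => by simp at h⟩

/-- A growing self-avoiding walk on `G`, given by its list of vertices in order: consecutive
vertices are adjacent, no vertex is visited twice, and the endpoint is trapped, that is, all its
neighbours have been visited. (The empty list is let through; see `IsGreekKeyTour`.) -/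
def IsGSAW {V : Type*} (G : SimpleGraph V) (w : List V) : Prop :=
  w.IsChain G.Adj ∧ w.Nodup ∧ ∀ v ∈ w.getLast?, ∀ u, G.Adj v u → u ∈ w

/-- The points of the `k × n` grid, of height `k` and width `n`: `{0, …, n-1} × {0, …, k-1}`. -/
def gridPoints (k n : ℕ) : Set (ℤ × ℤ) :=
  {p | 0 ≤ p.1 ∧ p.1 < n ∧ 0 ≤ p.2 ∧ p.2 < k}

/-- A Greek key tour of the `k × n` grid: a growing self-avoiding walk on the finite grid graph
that starts in the upper-left corner `(0, k-1)` and visits every vertex.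
For `k, n ≥ 1` the list is nonempty, since it contains every vertex. The grid with `n = 0` columns
has exactly one tour, the empty one, so that the generating function has constant term `1`. -/
def IsGreekKeyTour (k n : ℕ) (w : List (gridPoints k n)) : Prop :=
  IsGSAW (gridGraph (gridPoints k n)) w ∧
    (∀ v ∈ w.head?, (v : ℤ × ℤ) = (0, (k : ℤ) - 1)) ∧
    ∀ v, v ∈ w

/-- The number `g_{k,n}` of Greek key tours of the `k × n` grid. -/
noncomputable def greekKeyCount (k n : ℕ) : ℕ :=
  {w : List (gridPoints k n) | IsGreekKeyTour k n w}.ncard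

/-- The generating function `G_k(x) = ∑ₙ g_{k,n} xⁿ`, as a formal power series over `ℚ`. -/
noncomputable def greekKeySeries (k : ℕ) : PowerSeries ℚ :=
  PowerSeries.mk fun n => (greekKeyCount k n : ℚ)

/-!
A path that passes through a vertex `v` is determined by the pair of neighbours of `v` on it and the
path that remains when `v` is cut out and this pair becomes a link, a step the shorter path has to
take. So the number of paths on a vertex set is a sum of numbers of paths with links on the set
without `v`. Here the starting cell of a tour is prescribed by a link to an extra vertex, and the
final cell is left free by another extra vertex that is adjacent to every cell. Cutting out the
cells column by column, one finds only finitely many sets of links up to translation, and grouping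
those with the same numbers of completions leaves a transfer system on 22 classes. As the system is
linear, the completion numbers of all classes satisfy the recurrence as soon as they do so once, and
the recurrence says that the series times the denominator is the numerator.
-/

section PathEdges

variable {α β : Type*}

/-- The edges traversed by a list of vertices: the unordered pairs of its consecutive entries. -/
def pathEdges : List α → List (Sym2 α)
  | [] => []
  | [_] => []
  | a :: b :: l => s(a, b) :: pathEdges (b :: l)

theorem pathEdges_append_cons (p : List α) (a : α) (q : List α) :
    pathEdges (p ++ a :: q) = pathEdges (p ++ [a]) ++ pathEdges (a :: q) := by
  induction p with
  | nil => simp [pathEdges]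
  | cons x p ih =>
    cases p with
    | nil => simp [pathEdges]
    | cons y p => simpa [pathEdges] using ih

theorem pathEdges_map (f : α → β) (l : List α) :
    pathEdges (l.map f) = (pathEdges l).map (Sym2.map f) := by
  induction l with
  | nil => rfl
  | cons x l ih =>
    cases l with
    | nil => rfl
    | cons y l => simpa [pathEdges] using ih

theorem isChain_adj_iff_forall_pathEdges {G : SimpleGraph α} {l : List α} :
    l.IsChain G.Adj ↔ ∀ z ∈ pathEdges l, z ∈ G.edgeSet := by
  induction l with
  | nil => simp [pathEdges]
  | cons x l ih =>
    cases l with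
    | nil => simp [pathEdges]
    | cons y l => simp [pathEdges, ih]

theorem exists_append_of_mem_pathEdges {l : List α} {z : Sym2 α} (h : z ∈ pathEdges l) :
    ∃ p a b q, l = p ++ a :: b :: q ∧ z = s(a, b) := by
  induction l with
  | nil => simp [pathEdges] at h
  | cons x l ih =>
    cases l with
    | nil => simp [pathEdges] at h
    | cons y l =>
      rcases List.mem_cons.1 h with h | h
      · exact ⟨[], x, y, l, rfl, h⟩
      · obtain ⟨p, a, b, q, hl, hz⟩ := ih h
        exact ⟨x :: p, a, b, q, by rw [hl, List.cons_append], hz⟩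

theorem mem_of_mem_pathEdges {l : List α} {z : Sym2 α} {x : α} (h : z ∈ pathEdges l)
    (hx : x ∈ z) : x ∈ l := by
  obtain ⟨p, a, b, q, rfl, rfl⟩ := exists_append_of_mem_pathEdges h
  rcases Sym2.mem_iff.1 hx with rfl | rfl <;> simp

theorem mem_pathEdges_append_cons_cons {p q : List α} {a b : α} {z : Sym2 α} :
    z ∈ pathEdges (p ++ a :: b :: q) ↔
      z ∈ pathEdges (p ++ [a]) ∨ z = s(a, b) ∨ z ∈ pathEdges (b :: q) := by
  rw [pathEdges_append_cons, pathEdges, List.mem_append, List.mem_cons]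

variable {p q : List α} {a b v x : α} {z : Sym2 α}

theorem eq_of_mem_pathEdges_cons_cons (hn : (v :: b :: q).Nodup)
    (hz : z ∈ pathEdges (v :: b :: q)) (hv : v ∈ z) : z = s(v, b) :=
  (List.mem_cons.1 hz).resolve_right fun h =>
    (List.nodup_cons.1 hn).1 (mem_of_mem_pathEdges h hv)

theorem eq_of_mem_pathEdges_append_pair (hn : (p ++ [a, v]).Nodup)
    (hz : z ∈ pathEdges (p ++ [a, v])) (hv : v ∈ z) : z = s(v, a) := by
  have hvp : v ∉ p ++ [a] := by grind
  rcases mem_pathEdges_append_cons_cons.1 hz with h | h | h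
  · exact absurd (mem_of_mem_pathEdges h hv) hvp
  · rw [h, Sym2.eq_swap]
  · simp [pathEdges] at h

theorem eq_or_eq_of_mem_pathEdges_of_mem (hn : (p ++ a :: v :: b :: q).Nodup)
    (hz : z ∈ pathEdges (p ++ a :: v :: b :: q)) (hv : v ∈ z) : z = s(v, a) ∨ z = s(v, b) := by
  rw [List.append_cons, pathEdges_append_cons, ← List.append_cons, List.mem_append] at hz
  exact hz.imp (fun h => eq_of_mem_pathEdges_append_pair (by grind) h hv)
    fun h => eq_of_mem_pathEdges_cons_cons (by grind) h hv

theorem mk_mem_pathEdges_iff (hn : (p ++ a :: v :: b :: q).Nodup) :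
    s(v, x) ∈ pathEdges (p ++ a :: v :: b :: q) ↔ x ∈ s(a, b) := by
  constructor
  · intro h
    rcases eq_or_eq_of_mem_pathEdges_of_mem hn h (Sym2.mem_mk_left v x) with h | h <;>
      simp [Sym2.congr_right.1 h]
  · intro h
    rw [mem_pathEdges_append_cons_cons]
    rcases Sym2.mem_iff.1 h with rfl | rfl
    · exact Or.inr (Or.inl Sym2.eq_swap)
    · exact Or.inr (Or.inr List.mem_cons_self)

theorem mk_notMem_pathEdges_of_separated (hn : (p ++ a :: v :: b :: q).Nodup) :
    s(a, b) ∉ pathEdges (p ++ a :: v :: b :: q) := by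
  rw [List.append_cons, pathEdges_append_cons, ← List.append_cons, List.mem_append]
  rintro (h | h)
  · have hb : b ∈ p ++ [a, v] := mem_of_mem_pathEdges h (Sym2.mem_mk_right a b)
    grind
  · have ha : a ∈ v :: b :: q := mem_of_mem_pathEdges h (Sym2.mem_mk_left a b)
    grind

theorem mem_pathEdges_insert_iff (hv : v ∉ z) (hz : z ≠ s(a, b)) :
    z ∈ pathEdges (p ++ a :: v :: b :: q) ↔ z ∈ pathEdges (p ++ a :: b :: q) := by
  have hav : z ≠ s(a, v) := by rintro rfl; simp at hv
  have hvb : z ≠ s(v, b) := by rintro rfl; simp at hv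
  simp only [mem_pathEdges_append_cons_cons, pathEdges, List.mem_cons, hz, hav, hvb, false_or]

theorem eq_of_append_cons_cons_eq {p' q' : List α} {a' b' : α} (hn : (p ++ a :: b :: q).Nodup)
    (h : p ++ a :: b :: q = p' ++ a' :: b' :: q') (hab : s(a, b) = s(a', b')) :
    p = p' ∧ a = a' ∧ b = b' ∧ q = q' := by
  have hap : a ∉ p := by grind
  have hbq : a ∉ b :: q := by grind
  rcases Sym2.eq_iff.1 hab with ⟨rfl, rfl⟩ | ⟨rfl, rfl⟩
  · obtain ⟨hp, -, hq⟩ := (List.append_cons_inj_of_notMem hap hbq).1 h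
    exact ⟨hp, rfl, rfl, (List.cons.inj hq).2⟩
  · obtain ⟨rfl, -, -⟩ := (List.append_cons_inj_of_notMem hap hbq).1 ((List.append_cons p' b _) ▸ h)
    grind

theorem exists_eq_append_of_mem {l : List α} (hv : v ∈ l) (hhead : l.head? ≠ some v)
    (hlast : l.getLast? ≠ some v) : ∃ p a b q, l = p ++ a :: v :: b :: q := by
  obtain ⟨p, q, rfl⟩ := List.append_of_mem hv
  rcases List.eq_nil_or_concat p with rfl | ⟨p, a, rfl⟩
  · simp at hhead
  · cases q with
    | nil => simp at hlast
    | cons b q => exact ⟨p, a, b, q, by simp⟩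

variable [DecidableEq α]

/-- The number of edges at `x` that a path from `u` to `w` can traverse at most. -/
def capacity (u w x : α) : ℕ := if x = u ∨ x = w then 1 else 2

theorem card_filter_mem_le_capacity {u w : α} {l : List α} {N : Finset (Sym2 α)} (hn : l.Nodup)
    (hhead : l.head? = some u) (hlast : l.getLast? = some w) (hN : ∀ z ∈ N, z ∈ pathEdges l) :
    (N.filter (x ∈ ·)).card ≤ capacity u w x := by
  by_cases hx : x ∈ l
  swap
  · rw [Finset.filter_false_of_mem fun z hz hxz => hx (mem_of_mem_pathEdges (hN z hz) hxz)]
    exact Nat.zero_le _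
  have card_le_one (y : Sym2 α) (hy : ∀ z ∈ pathEdges l, x ∈ z → z = y) :
      (N.filter (x ∈ ·)).card ≤ 1 :=
    Finset.card_le_one.2 (by grind)
  unfold capacity
  split_ifs with hends
  · rcases hends with rfl | rfl
    · obtain ⟨t, rfl⟩ := List.head?_eq_some_iff.1 hhead
      cases t with
      | nil => exact card_le_one s(x, x) (by simp [pathEdges])
      | cons b q => exact card_le_one s(x, b) fun z => eq_of_mem_pathEdges_cons_cons hn
    · obtain ⟨t, rfl⟩ := List.getLast?_eq_some_iff.1 hlast
      rcases List.eq_nil_or_concat t with rfl | ⟨p, a, rfl⟩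
      · exact card_le_one s(x, x) (by simp [pathEdges])
      · rw [List.concat_eq_append, ← List.append_cons] at hn card_le_one
        exact card_le_one s(x, a) fun z => eq_of_mem_pathEdges_append_pair hn
  · rw [not_or] at hends
    obtain ⟨p, a, b, q, rfl⟩ := exists_eq_append_of_mem hx
      (by simpa [hhead] using Ne.symm hends.1) (by simpa [hlast] using Ne.symm hends.2)
    refine (Finset.card_le_card (t := {s(x, a), s(x, b)}) fun z hz => ?_).trans Finset.card_le_two
    have := eq_or_eq_of_mem_pathEdges_of_mem hn (hN z (by grind)) (by grind)
    simpa using this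

end PathEdges

section LinkedPath

variable {α β : Type*}

/-- `l` is a path from `u` to `w` through exactly the vertices in `U` that uses edges of `G` and
links, the pairs in `M`, and that traverses every link. A link stands for a piece of a longer path
whose interior vertices have been eliminated; it need not be an edge of `G`. -/
structure IsLinkedPath (G : SimpleGraph α) (M : Finset (Sym2 α)) (U : Finset α) (u w : α)
    (l : List α) : Prop where
  nodup : l.Nodup
  mem_iff : ∀ x, x ∈ l ↔ x ∈ U
  head_eq : l.head? = some u
  last_eq : l.getLast? = some w
  edge_or_link : ∀ z ∈ pathEdges l, z ∈ G.edgeSet ∨ z ∈ M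
  link_mem : ∀ z ∈ M, z ∈ pathEdges l

/-- The number of linked paths from `u` to `w` with vertex set `U`. -/
noncomputable def linkedPathCount (G : SimpleGraph α) (M : Finset (Sym2 α)) (U : Finset α)
    (u w : α) : ℕ :=
  {l | IsLinkedPath G M U u w l}.ncard

variable {G : SimpleGraph α} {M : Finset (Sym2 α)} {U : Finset α} {u w v : α} {z : Sym2 α}
  {l : List α}

theorem finite_setOf_isLinkedPath : {l | IsLinkedPath G M U u w l}.Finite := by
  classical
  refine U.val.lists.finite_toSet.subset fun l hl => ?_
  have hlU : (l : Multiset α) = U.val :=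
    (Multiset.Nodup.ext (Multiset.coe_nodup.2 hl.nodup) U.nodup).2 hl.mem_iff
  exact (Multiset.mem_lists_iff _ _).2 hlU.symm

theorem IsLinkedPath.exists_eq_append (hl : IsLinkedPath G M U u w l) (hv : v ∈ U) (hu : v ≠ u)
    (hw : v ≠ w) : ∃ p a b q, l = p ++ a :: v :: b :: q :=
  exists_eq_append_of_mem ((hl.mem_iff v).2 hv) (by simpa [hl.head_eq] using hu.symm)
    (by simpa [hl.last_eq] using hw.symm)

theorem IsLinkedPath.eq_pair (hl : IsLinkedPath G M U u w l) (h : s(u, w) ∈ pathEdges l) :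
    l = [u, w] := by
  obtain ⟨t, rfl⟩ := List.head?_eq_some_iff.1 hl.head_eq
  cases t with
  | nil => simp [pathEdges] at h
  | cons b q =>
    have hwb : w = b := Sym2.congr_right.1
      (eq_of_mem_pathEdges_cons_cons hl.nodup h (Sym2.mem_mk_left u w))
    have := hl.nodup
    have := hl.last_eq
    cases q <;> grind

section Contraction

/-- `z` consists of the two neighbours of `v` in the list `l`. -/
def IsNeighbourPair (l : List α) (v : α) (z : Sym2 α) : Prop :=
  ∃ p a b q, l = p ++ a :: v :: b :: q ∧ z = s(a, b)

theorem IsNeighbourPair.mem_iff (h : IsNeighbourPair l v z) (hn : l.Nodup) {x : α} :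
    x ∈ z ↔ s(v, x) ∈ pathEdges l := by
  obtain ⟨p, a, b, q, rfl, rfl⟩ := h
  exact (mk_mem_pathEdges_iff hn).symm

theorem IsNeighbourPair.unique {z' : Sym2 α} (h : IsNeighbourPair l v z)
    (h' : IsNeighbourPair l v z') (hn : l.Nodup) : z = z' :=
  Sym2.ext fun _ => (h.mem_iff hn).trans (h'.mem_iff hn).symm

/-- A path with links `M` may pass through `v` from one entry of `z` to the other: both steps are
edges of `G` or links, and there are no further links at `v`. As `z` is not yet a link, the path can
be recovered after `v` has been eliminated. -/
structure IsShortcut (G : SimpleGraph α) (M : Finset (Sym2 α)) (v : α) (z : Sym2 α) : Prop where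
  notMem : z ∉ M
  edge_or_link : ∀ x ∈ z, s(v, x) ∈ G.edgeSet ∨ s(v, x) ∈ M
  mem_of_link : ∀ x, s(v, x) ∈ M → x ∈ z

theorem IsLinkedPath.isShortcut (hl : IsLinkedPath G M U u w l) (hz : IsNeighbourPair l v z) :
    IsShortcut G M v z where
  notMem hzM := by
    obtain ⟨p, a, b, q, rfl, rfl⟩ := hz
    exact mk_notMem_pathEdges_of_separated hl.nodup (hl.link_mem _ hzM)
  edge_or_link x hx := hl.edge_or_link _ ((hz.mem_iff hl.nodup).1 hx)
  mem_of_link x hx := (hz.mem_iff hl.nodup).2 (hl.link_mem _ hx)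

variable [DecidableEq α] {p q : List α} {a b : α}

/-- The links that remain when `v` is eliminated from between its neighbours, the entries of `z`:
those at `v` are replaced with `z`. -/
def contractLinks (M : Finset (Sym2 α)) (v : α) (z : Sym2 α) : Finset (Sym2 α) :=
  insert z (M.filter (v ∉ ·))

theorem IsLinkedPath.eliminate (hl : IsLinkedPath G M U u w (p ++ a :: v :: b :: q)) :
    IsLinkedPath G (contractLinks M v s(a, b)) (U.erase v) u w (p ++ a :: b :: q) := by
  have hn := hl.nodup
  have hvl : v ∉ p ++ a :: b :: q := by grind
  have hab : s(a, b) ∉ M := (hl.isShortcut ⟨p, a, b, q, rfl, rfl⟩).notMem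
  refine ⟨by grind, fun x => ?_, ?_, ?_, fun z hz => ?_, fun z hz => ?_⟩
  · rw [Finset.mem_erase, ← hl.mem_iff]
    grind
  · rw [← hl.head_eq]
    cases p <;> rfl
  · simpa [List.getLast?_append] using hl.last_eq
  · by_cases hzab : z = s(a, b)
    · exact Or.inr (Finset.mem_insert.2 (Or.inl hzab))
    have hvz : v ∉ z := fun h => hvl (mem_of_mem_pathEdges hz h)
    exact (hl.edge_or_link z ((mem_pathEdges_insert_iff hvz hzab).2 hz)).imp_right
      fun hzM => Finset.mem_insert_of_mem (Finset.mem_filter.2 ⟨hzM, hvz⟩)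
  · rcases Finset.mem_insert.1 hz with rfl | hz
    · exact mem_pathEdges_append_cons_cons.2 (Or.inr (Or.inl rfl))
    · obtain ⟨hzM, hvz⟩ := Finset.mem_filter.1 hz
      exact (mem_pathEdges_insert_iff hvz (ne_of_mem_of_not_mem hzM hab)).1 (hl.link_mem z hzM)

theorem IsLinkedPath.reinsert (hab : IsShortcut G M v s(a, b)) (hv : v ∈ U)
    (hl : IsLinkedPath G (contractLinks M v s(a, b)) (U.erase v) u w (p ++ a :: b :: q)) :
    IsLinkedPath G M U u w (p ++ a :: v :: b :: q) := by
  have hvl : v ∉ p ++ a :: b :: q := fun h => Finset.notMem_erase v U ((hl.mem_iff v).1 h)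
  have hn : (p ++ a :: v :: b :: q).Nodup := by have := hl.nodup; grind
  refine ⟨hn, fun x => ?_, ?_, ?_, fun z hz => ?_, fun z hz => ?_⟩
  · have := hl.mem_iff x
    grind
  · rw [← hl.head_eq]
    cases p <;> rfl
  · simpa [List.getLast?_append] using hl.last_eq
  · by_cases hvz : v ∈ z
    · obtain ⟨x, rfl⟩ := hvz
      exact hab.edge_or_link x ((mk_mem_pathEdges_iff hn).1 hz)
    · have hzab : z ≠ s(a, b) := ne_of_mem_of_not_mem hz (mk_notMem_pathEdges_of_separated hn)
      refine (hl.edge_or_link z ((mem_pathEdges_insert_iff hvz hzab).1 hz)).imp_right fun hzM => ?_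
      exact (Finset.mem_filter.1 ((Finset.mem_insert.1 hzM).resolve_left hzab)).1
  · by_cases hvz : v ∈ z
    · obtain ⟨x, rfl⟩ := hvz
      exact (mk_mem_pathEdges_iff hn).2 (hab.mem_of_link x hz)
    · exact (mem_pathEdges_insert_iff hvz (ne_of_mem_of_not_mem hz hab.notMem)).2
        (hl.link_mem z (Finset.mem_insert_of_mem (Finset.mem_filter.2 ⟨hz, hvz⟩)))

theorem erase_append_cons_cons (hn : (p ++ a :: v :: b :: q).Nodup) :
    (p ++ a :: v :: b :: q).erase v = p ++ a :: b :: q := by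
  grind

theorem ncard_isLinkedPath_isNeighbourPair (hz : IsShortcut G M v z) (hv : v ∈ U) :
    {l | IsLinkedPath G M U u w l ∧ IsNeighbourPair l v z}.ncard =
      linkedPathCount G (contractLinks M v z) (U.erase v) u w := by
  refine Set.ncard_congr (fun l _ => l.erase v) ?_ ?_ ?_
  · rintro _ ⟨hl, p, a, b, q, rfl, rfl⟩
    rw [erase_append_cons_cons hl.nodup]
    exact hl.eliminate
  · rintro _ _ ⟨hl, p, a, b, q, rfl, rfl⟩ ⟨hl', p', a', b', q', rfl, hab⟩ h
    rw [erase_append_cons_cons hl.nodup, erase_append_cons_cons hl'.nodup] at h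
    obtain ⟨rfl, rfl, rfl, rfl⟩ := eq_of_append_cons_cons_eq hl.eliminate.nodup h hab
    rfl
  · intro l hl
    obtain ⟨p, a, b, q, rfl, rfl⟩ :=
      exists_append_of_mem_pathEdges (hl.link_mem z (Finset.mem_insert_self _ _))
    have hl' := IsLinkedPath.reinsert hz hv hl
    exact ⟨_, ⟨hl', p, a, b, q, rfl, rfl⟩, erase_append_cons_cons hl'.nodup⟩

theorem linkedPathCount_eq_sum (hv : v ∈ U) (hu : v ≠ u) (hw : v ≠ w) {Z : Finset (Sym2 α)}
    (hZ : ∀ z ∈ Z, IsShortcut G M v z)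
    (hall : ∀ l z, IsLinkedPath G M U u w l → IsNeighbourPair l v z → z ∈ Z) :
    linkedPathCount G M U u w =
      ∑ z ∈ Z, linkedPathCount G (contractLinks M v z) (U.erase v) u w := by
  have hunion : {l | IsLinkedPath G M U u w l} =
      ⋃ z ∈ (Z : Set (Sym2 α)), {l | IsLinkedPath G M U u w l ∧ IsNeighbourPair l v z} := by
    ext l
    refine ⟨fun hl => ?_, fun hl => ?_⟩
    · obtain ⟨p, a, b, q, rfl⟩ := hl.exists_eq_append hv hu hw
      have hab : IsNeighbourPair (p ++ a :: v :: b :: q) v s(a, b) := ⟨p, a, b, q, rfl, rfl⟩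
      exact Set.mem_biUnion (hall _ _ hl hab) ⟨hl, hab⟩
    · obtain ⟨z, -, hl, -⟩ := Set.mem_iUnion₂.1 hl
      exact hl
  rw [← Finset.sum_congr rfl fun z hz => ncard_isLinkedPath_isNeighbourPair (hZ z hz) hv,
    linkedPathCount, hunion, Set.Finite.ncard_biUnion Z.finite_toSet, finsum_mem_coe_finset]
  · exact fun z _ => finite_setOf_isLinkedPath.subset fun l hl => hl.1
  · intro z _ z' _ hzz'
    exact Set.disjoint_left.2 fun l hl hl' => hzz' (hl.2.unique hl'.2 hl.1.nodup)

end Contraction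

section Shortcuts

variable [DecidableEq α]

theorem IsLinkedPath.card_links_lt_capacity (hl : IsLinkedPath G M U u w l) {x : α}
    (hz : z ∈ pathEdges l) (hzM : z ∉ M) (hx : x ∈ z) :
    (M.filter (x ∈ ·)).card < capacity u w x := by
  have hinsert := card_filter_mem_le_capacity (x := x) hl.nodup hl.head_eq hl.last_eq
    (N := insert z M) (by have := hl.link_mem; grind)
  rw [Finset.filter_insert, if_pos hx, Finset.card_insert_of_notMem (by grind)] at hinsert
  exact hinsert

theorem IsLinkedPath.mem_of_closed (hl : IsLinkedPath G M U u w l) (hu : v ≠ u) (hw : v ≠ w)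
    (hv : v ∈ U) (hz : IsNeighbourPair l v z) (hclosed : s(u, w) ∈ insert z M) :
    ∀ y ∈ M, v ∈ y := by
  have hz' := (hl.isShortcut hz).notMem
  have huw : s(u, w) ∉ M := fun h => by
    have hvl := (hl.mem_iff v).2 hv
    rw [hl.eq_pair (hl.link_mem _ h)] at hvl
    simp [hu, hw] at hvl
  obtain rfl : s(u, w) = z := (Finset.mem_insert.1 hclosed).resolve_right huw
  intro y hy
  by_contra hvy
  obtain ⟨p, a, b, q, rfl, hab⟩ := hz
  have hl' := hl.eliminate
  rw [← hab] at hl'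
  have hyl := hl'.link_mem y (Finset.mem_insert_of_mem (Finset.mem_filter.2 ⟨hy, hvy⟩))
  rw [hl'.eq_pair (hl'.link_mem _ (Finset.mem_insert_self _ _))] at hyl
  simp only [pathEdges, List.mem_singleton] at hyl
  exact huw (hyl ▸ hy)

variable [DecidableRel G.Adj] {N : Finset α}

/-- The vertices that may be next to `v` on a path from `u` to `w` with links `M`: the other ends of
the links at `v` and the neighbours of `v` with a spare place. The candidates for the latter are
looked for in `N` and among the ends of links at `v`. -/
def shortcutEnds (G : SimpleGraph α) [DecidableRel G.Adj] (u w : α) (M : Finset (Sym2 α)) (v : α)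
    (N : Finset α) : Finset α :=
  (N ∪ (M.filter (v ∈ ·)).biUnion Sym2.toFinset).filter fun x =>
    s(v, x) ∈ M ∨ G.Adj v x ∧ (M.filter (x ∈ ·)).card < capacity u w x

/-- The pairs that may be the neighbours of `v` on a path from `u` to `w` with links `M`. The last
condition says that the link `s(u, w)` closes the path, and so must be the only one. -/
def shortcuts (G : SimpleGraph α) [DecidableRel G.Adj] (u w : α) (M : Finset (Sym2 α)) (v : α)
    (N : Finset α) : Finset (Sym2 α) :=
  (shortcutEnds G u w M v N).sym2.filter fun z =>
    ¬ z.IsDiag ∧ z ∉ M ∧ (∀ y ∈ M, v ∈ y → ∃ x ∈ z.toFinset, y = s(v, x)) ∧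
      (s(u, w) ∈ insert z M → ∀ y ∈ M, v ∈ y)

theorem isShortcut_of_mem_shortcuts (hz : z ∈ shortcuts G u w M v N) : IsShortcut G M v z := by
  obtain ⟨hends, -, hzM, hlinks, -⟩ := Finset.mem_filter.1 hz
  refine ⟨hzM, fun x hx => ?_, fun x hx => ?_⟩
  · obtain ⟨-, hvx⟩ := Finset.mem_filter.1 (Finset.mem_sym2_iff.1 hends x hx)
    exact hvx.symm.imp_left And.left
  · obtain ⟨y, hy, hxy⟩ := hlinks _ hx (Sym2.mem_mk_left v x)
    exact Sym2.congr_right.1 hxy ▸ Sym2.mem_toFinset.1 hy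

theorem IsLinkedPath.mem_shortcuts (hl : IsLinkedPath G M U u w l) (hv : v ∈ U) (hu : v ≠ u)
    (hw : v ≠ w) (hN : ∀ x ∈ U, G.Adj v x → x ∈ N) (hz : IsNeighbourPair l v z) :
    z ∈ shortcuts G u w M v N := by
  have hshort := hl.isShortcut hz
  refine Finset.mem_filter.2 ⟨Finset.mem_sym2_iff.2 fun x hx => ?_, ?_, hshort.notMem, ?_,
    hl.mem_of_closed hu hw hv hz⟩
  · have hvx := (hz.mem_iff hl.nodup).1 hx
    have hxU := (hl.mem_iff x).1 (mem_of_mem_pathEdges hvx (Sym2.mem_mk_right v x))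
    by_cases hM : s(v, x) ∈ M
    · refine Finset.mem_filter.2 ⟨Finset.mem_union_right _ ?_, Or.inl hM⟩
      exact Finset.mem_biUnion.2 ⟨_, Finset.mem_filter.2 ⟨hM, Sym2.mem_mk_left v x⟩, by simp⟩
    · have hadj := (hshort.edge_or_link x hx).resolve_right hM
      refine Finset.mem_filter.2 ⟨Finset.mem_union_left _ (hN x hxU hadj), Or.inr ⟨hadj, ?_⟩⟩
      exact hl.card_links_lt_capacity hvx hM (Sym2.mem_mk_right v x)
  · obtain ⟨p, a, b, q, rfl, rfl⟩ := hz
    have := hl.nodup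
    rw [Sym2.mk_isDiag_iff]
    grind
  · rintro y hy ⟨x, rfl⟩
    exact ⟨x, Sym2.mem_toFinset.2 (hshort.mem_of_link x hy), rfl⟩

theorem linkedPathCount_eq_sum_shortcuts (hv : v ∈ U) (hu : v ≠ u) (hw : v ≠ w)
    (hN : ∀ x ∈ U, G.Adj v x → x ∈ N) :
    linkedPathCount G M U u w = ∑ z ∈ shortcuts G u w M v N,
      linkedPathCount G (contractLinks M v z) (U.erase v) u w :=
  linkedPathCount_eq_sum hv hu hw (fun _ => isShortcut_of_mem_shortcuts)
    fun _ _ hl => hl.mem_shortcuts hv hu hw hN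

end Shortcuts

theorem isLinkedPath_pair_iff [DecidableEq α] (huw : u ≠ w) (hadj : ¬ G.Adj u w) :
    IsLinkedPath G M {u, w} u w l ↔ M = {s(u, w)} ∧ l = [u, w] := by
  constructor
  · intro hl
    have hperm : l.Perm [u, w] :=
      (List.perm_ext_iff_of_nodup hl.nodup (by simpa using huw)).2 (by simpa using hl.mem_iff)
    obtain ⟨a, b, rfl⟩ := List.length_eq_two.1 hperm.length_eq
    obtain rfl : a = u := Option.some.inj hl.head_eq
    obtain rfl : b = w := Option.some.inj hl.last_eq
    have hMab := (hl.edge_or_link s(a, b) List.mem_cons_self).resolve_left hadj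
    refine ⟨Finset.eq_singleton_iff_unique_mem.2 ⟨hMab, fun z hz => ?_⟩, rfl⟩
    exact List.mem_singleton.1 (hl.link_mem z hz)
  · rintro ⟨rfl, rfl⟩
    refine ⟨by simpa using huw, by simp, rfl, rfl, ?_, ?_⟩ <;> simp [pathEdges]

theorem linkedPathCount_pair [DecidableEq α] (huw : u ≠ w) (hadj : ¬ G.Adj u w) :
    linkedPathCount G M {u, w} u w = if M = {s(u, w)} then 1 else 0 := by
  simp only [linkedPathCount, isLinkedPath_pair_iff huw hadj]
  split_ifs with h <;> simp [h]

theorem isLinkedPath_map_iff {H : SimpleGraph β} (f : G ↪g H) :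
    IsLinkedPath H (M.map f.toEmbedding.sym2Map) (U.map f.toEmbedding) (f u) (f w) (l.map f) ↔
      IsLinkedPath G M U u w l := by
  have hf := f.injective
  have hedges (z : Sym2 α) : Sym2.map f z ∈ pathEdges (l.map f) ↔ z ∈ pathEdges l := by
    rw [pathEdges_map, List.mem_map_of_injective (Sym2.map.injective hf)]
  have hlinks (z : Sym2 α) : Sym2.map f z ∈ M.map f.toEmbedding.sym2Map ↔ z ∈ M :=
    Finset.mem_map' f.toEmbedding.sym2Map
  constructor
  · refine fun hl => ⟨hl.nodup.of_map, fun x => ?_, ?_, ?_, fun z hz => ?_, fun z hz => ?_⟩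
    · rw [← List.mem_map_of_injective hf, hl.mem_iff]
      exact Finset.mem_map' f.toEmbedding
    · simpa [hf.eq_iff] using hl.head_eq
    · simpa [hf.eq_iff] using hl.last_eq
    · rw [← hlinks, ← f.map_mem_edgeSet_iff]
      exact hl.edge_or_link _ ((hedges z).2 hz)
    · exact (hedges z).1 (hl.link_mem _ ((hlinks z).2 hz))
  · refine fun hl => ⟨hl.nodup.map hf, fun x => ?_, ?_, ?_, fun z hz => ?_, fun z hz => ?_⟩
    · simp [hl.mem_iff]
    · simp [hl.head_eq]
    · simp [hl.last_eq]
    · rw [pathEdges_map] at hz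
      obtain ⟨z, hzl, rfl⟩ := List.mem_map.1 hz
      rw [hlinks, f.map_mem_edgeSet_iff]
      exact hl.edge_or_link z hzl
    · obtain ⟨z, hzM, rfl⟩ := Finset.mem_map.1 hz
      exact (hedges z).2 (hl.link_mem z hzM)

theorem linkedPathCount_map {H : SimpleGraph β} (f : G ↪g H) :
    linkedPathCount H (M.map f.toEmbedding.sym2Map) (U.map f.toEmbedding) (f u) (f w) =
      linkedPathCount G M U u w := by
  rw [linkedPathCount, linkedPathCount,
    ← Set.ncard_image_of_injective _ (List.map_injective_iff.2 f.injective)]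
  congr 1
  ext l
  constructor
  · intro hl
    have hrange : l ∈ Set.range (List.map f) := by
      rw [Set.range_list_map]
      intro x hx
      obtain ⟨y, -, rfl⟩ := Finset.mem_map.1 ((hl.mem_iff x).1 hx)
      exact Set.mem_range_self y
    obtain ⟨l, rfl⟩ := hrange
    exact ⟨l, (isLinkedPath_map_iff f).1 hl, rfl⟩
  · rintro ⟨l, hl, rfl⟩
    exact (isLinkedPath_map_iff f).2 hl

end LinkedPath

section Strip

variable {k v N : ℕ} {M : Finset (Sym2 ℕ)}

/-- The cells of an infinite strip of height `k`, numbered from `2` on by columns and from top to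
bottom within a column, together with a vertex `1` adjacent to every cell and an isolated vertex
`0`. The vertices `0` and `1` serve as the ends of a path: the start in a given cell is prescribed
by a link at `0`, whereas the end is free. -/
def stripGraph (k : ℕ) : SimpleGraph ℕ :=
  SimpleGraph.fromRel fun x y => 2 ≤ x ∧ (y = 1 ∨ y = x + k ∨ y = x + 1 ∧ ¬ k ∣ x - 1)

instance (k : ℕ) : DecidableRel (stripGraph k).Adj := fun x y =>
  inferInstanceAs (Decidable (x ≠ y ∧
    ((2 ≤ x ∧ (y = 1 ∨ y = x + k ∨ y = x + 1 ∧ ¬ k ∣ x - 1)) ∨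
      (2 ≤ y ∧ (x = 1 ∨ x = y + k ∨ x = y + 1 ∧ ¬ k ∣ y - 1)))))

theorem stripGraph_adj {x y : ℕ} : (stripGraph k).Adj x y ↔ x ≠ y ∧
    ((2 ≤ x ∧ (y = 1 ∨ y = x + k ∨ y = x + 1 ∧ ¬ k ∣ x - 1)) ∨
      2 ≤ y ∧ (x = 1 ∨ x = y + k ∨ x = y + 1 ∧ ¬ k ∣ y - 1)) :=
  Iff.rfl

/-- The two end vertices of the strip and the cells numbered from `v` to `N - 1`. -/
def stripVertices (v N : ℕ) : Finset ℕ := insert 0 (insert 1 (Finset.Ico v N))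

theorem mem_stripVertices {x : ℕ} : x ∈ stripVertices v N ↔ x < 2 ∨ v ≤ x ∧ x < N := by
  simp only [stripVertices, Finset.mem_insert, Finset.mem_Ico]
  omega

/-- The number of linked paths in the strip between its two end vertices when the cells before `v`
have been eliminated and those from `N` on are absent. -/
noncomputable def stripCount (k v N : ℕ) (M : Finset (Sym2 ℕ)) : ℕ :=
  linkedPathCount (stripGraph k) M (stripVertices v N) 0 1

theorem stripCount_self (k N : ℕ) (M : Finset (Sym2 ℕ)) :
    stripCount k N N M = if M = {s(0, 1)} then 1 else 0 := by
  have h : stripVertices N N = {0, 1} := by simp [stripVertices]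
  rw [stripCount, h, linkedPathCount_pair zero_ne_one (by simp [stripGraph_adj])]

/-- The shortcuts through the cell `v` once all earlier cells have been eliminated. -/
def stripShortcuts (k v : ℕ) (M : Finset (Sym2 ℕ)) : Finset (Sym2 ℕ) :=
  shortcuts (stripGraph k) 0 1 M v {1, v + 1, v + k}

theorem stripCount_eq_sum (hv : 2 ≤ v) (hvN : v < N) :
    stripCount k v N M =
      ∑ z ∈ stripShortcuts k v M, stripCount k (v + 1) N (contractLinks M v z) := by
  have hmem : v ∈ stripVertices v N := mem_stripVertices.2 (Or.inr ⟨le_rfl, hvN⟩)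
  have hforward (x : ℕ) (hx : x ∈ stripVertices v N) (hadj : (stripGraph k).Adj v x) :
      x ∈ ({1, v + 1, v + k} : Finset ℕ) := by
    rw [mem_stripVertices] at hx
    rw [stripGraph_adj] at hadj
    simp only [Finset.mem_insert, Finset.mem_singleton]
    omega
  have herase : (stripVertices v N).erase v = stripVertices (v + 1) N := by
    ext x
    rw [Finset.mem_erase, mem_stripVertices, mem_stripVertices]
    omega
  rw [stripCount, linkedPathCount_eq_sum_shortcuts hmem (by omega) (by omega) hforward, herase]
  rfl

/-- The sets of links that can arise from `M`, with multiplicity, when `i` consecutive cells are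
eliminated, the first of them being `v`. -/
def sweep (k : ℕ) : ℕ → ℕ → Finset (Sym2 ℕ) → Multiset (Finset (Sym2 ℕ))
  | 0, _, M => {M}
  | i + 1, v, M =>
    ((stripShortcuts k v M).val.map (contractLinks M v)).bind (sweep k i (v + 1))

theorem stripCount_eq_sum_sweep (hv : 2 ≤ v) (i : ℕ) (hi : v + i ≤ N) :
    stripCount k v N M = ((sweep k i v M).map (stripCount k (v + i) N)).sum := by
  induction i generalizing v M with
  | zero => simp [sweep]
  | succ i ih =>
    rw [stripCount_eq_sum hv (by omega), sweep, Multiset.map_bind, Multiset.sum_bind,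
      Multiset.map_map]
    refine congrArg Multiset.sum (Multiset.map_congr rfl fun z _ => ?_)
    rw [ih (by omega) (by omega), Nat.add_right_comm, Nat.add_assoc, Function.comp_apply]

/-- The translation of the strip by one column. -/
def stripShift (k : ℕ) : stripGraph k ↪g stripGraph k where
  toFun x := if x < 2 then x else x + k
  inj' x y h := by
    dsimp only at h
    split_ifs at h <;> omega
  map_rel_iff' {x y} := by
    have hdvd {x : ℕ} (hx : 2 ≤ x) : k ∣ x + k - 1 ↔ k ∣ x - 1 := by
      rw [Nat.sub_add_comm (by omega), Nat.dvd_add_self_right]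
    change (stripGraph k).Adj (if x < 2 then x else x + k) (if y < 2 then y else y + k) ↔ _
    rw [stripGraph_adj, stripGraph_adj]
    split_ifs with hx hy hy
    · rfl
    · rw [hdvd (by omega)]
      omega
    · rw [hdvd (by omega)]
      omega
    · rw [hdvd (by omega), hdvd (by omega)]
      omega

theorem stripShift_apply (k x : ℕ) : stripShift k x = if x < 2 then x else x + k :=
  rfl

theorem stripVertices_map_stripShift (hv : 2 ≤ v) :
    (stripVertices v N).map (stripShift k).toEmbedding = stripVertices (v + k) (N + k) := by
  ext x
  simp only [Finset.mem_map, mem_stripVertices, RelEmbedding.coe_toEmbedding, stripShift_apply]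
  constructor
  · rintro ⟨x, hx, rfl⟩
    split_ifs <;> omega
  · intro hx
    refine ⟨if x < 2 then x else x - k, ?_, ?_⟩ <;> split_ifs <;> omega

theorem stripCount_map_stripShift (hv : 2 ≤ v) :
    stripCount k (v + k) (N + k) (M.map (stripShift k).toEmbedding.sym2Map) =
      stripCount k v N M := by
  rw [stripCount, ← stripVertices_map_stripShift hv]
  exact linkedPathCount_map (stripShift k) (u := 0) (w := 1)

/-- `l` is a path in the strip, starting in the first cell, through exactly the cells numbered from
`2` to `N - 1`. -/
structure IsStripTour (k N : ℕ) (l : List ℕ) : Prop where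
  nodup : l.Nodup
  mem_iff : ∀ x, x ∈ l ↔ 2 ≤ x ∧ x < N
  isChain : l.IsChain (stripGraph k).Adj
  head_eq : l.head? = some 2

variable {l : List ℕ}

theorem isStripTour_of_isLinkedPath
    (hl : IsLinkedPath (stripGraph k) {s(0, 2)} (stripVertices 2 N) 0 1 (0 :: (l ++ [1]))) :
    IsStripTour k N l := by
  have hn := hl.nodup
  have hcells (x : ℕ) : x ∈ l ↔ 2 ≤ x ∧ x < N := by
    have := mem_stripVertices.symm.trans (hl.mem_iff x).symm
    grind
  have hstart := hl.link_mem _ (Finset.mem_singleton_self _)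
  cases l with
  | nil => simp [pathEdges] at hstart
  | cons b t =>
    obtain rfl : 2 = b := Sym2.congr_right.1
      (eq_of_mem_pathEdges_cons_cons hn hstart (Sym2.mem_mk_left 0 2))
    have hchain : (2 :: t ++ [1]).IsChain (stripGraph k).Adj := by
      refine isChain_adj_iff_forall_pathEdges.2 fun z hz => ?_
      refine (hl.edge_or_link z (List.mem_cons_of_mem _ hz)).resolve_right fun hz0 => ?_
      obtain rfl := Finset.mem_singleton.1 hz0
      exact (List.nodup_cons.1 hn).1 (mem_of_mem_pathEdges hz (Sym2.mem_mk_left 0 2))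
    exact ⟨by grind, hcells, hchain.left_of_append, rfl⟩

theorem IsStripTour.isLinkedPath (hl : IsStripTour k N l) :
    IsLinkedPath (stripGraph k) {s(0, 2)} (stripVertices 2 N) 0 1 (0 :: (l ++ [1])) := by
  obtain ⟨hn, hcells, hchain, hhead⟩ := hl
  obtain ⟨t, rfl⟩ := List.head?_eq_some_iff.1 hhead
  have hchain' : (2 :: t ++ [1]).IsChain (stripGraph k).Adj := by
    refine hchain.append (List.isChain_singleton 1) fun x hx y hy => ?_
    have hx := ((hcells x).1 (List.mem_of_mem_getLast? hx)).1
    obtain rfl : 1 = y := Option.some.inj hy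
    exact stripGraph_adj.2 ⟨by omega, Or.inl ⟨hx, Or.inl rfl⟩⟩
  refine ⟨by grind, fun x => ?_, rfl, List.getLast?_concat (l := 0 :: 2 :: t), fun z hz => ?_,
    fun z hz => Finset.mem_singleton.1 hz ▸ List.mem_cons_self⟩
  · rw [mem_stripVertices, ← hcells]
    grind
  · rcases List.mem_cons.1 hz with rfl | hz
    · exact Or.inr (Finset.mem_singleton_self _)
    · exact Or.inl (isChain_adj_iff_forall_pathEdges.1 hchain' z hz)

theorem ncard_isStripTour (k N : ℕ) :
    {l | IsStripTour k N l}.ncard = stripCount k 2 N {s(0, 2)} := by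
  refine Set.ncard_congr (fun l _ => 0 :: (l ++ [1])) (fun l hl => hl.isLinkedPath)
    (fun l l' _ _ h => List.append_cancel_right (List.cons.inj h).2) fun l hl => ?_
  obtain ⟨t, rfl⟩ := List.getLast?_eq_some_iff.1 hl.last_eq
  cases t with
  | nil => exact absurd hl.head_eq (by simp)
  | cons a t =>
    obtain rfl : a = 0 := Option.some.inj hl.head_eq
    exact ⟨t, isStripTour_of_isLinkedPath hl, rfl⟩

end Strip

section Grid

variable {k n : ℕ}

theorem mul_add_inj {c c' i i' : ℕ} (hi : i < k) (hi' : i' < k) :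
    k * c + i = k * c' + i' ↔ c = c' ∧ i = i' := by
  refine ⟨fun h => ?_, by rintro ⟨rfl, rfl⟩; rfl⟩
  have hmod := congrArg (· % k) h
  have hdiv := congrArg (· / k) h
  have hk : 0 < k := by omega
  simp only [Nat.mul_add_mod, Nat.mod_eq_of_lt hi, Nat.mod_eq_of_lt hi'] at hmod
  simp only [Nat.mul_add_div hk, Nat.div_eq_of_lt hi, Nat.div_eq_of_lt hi', add_zero] at hdiv
  exact ⟨hdiv, hmod⟩

/-- The number of a grid point in the strip. -/
def cellNumber (p : gridPoints k n) : ℕ := (k * p.1.1 + (k - 1 - p.1.2)).toNat + 2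

theorem exists_cellNumber_eq (p : gridPoints k n) :
    ∃ c i : ℕ, c < n ∧ i < k ∧ (p : ℤ × ℤ) = ((c : ℤ), (k : ℤ) - 1 - i) ∧
      cellNumber p = k * c + i + 2 := by
  obtain ⟨⟨x, y⟩, hx0, hxn, hy0, hyk⟩ := p
  dsimp only at hx0 hxn hy0 hyk
  obtain ⟨c, rfl⟩ := Int.eq_ofNat_of_zero_le hx0
  obtain ⟨i, hi⟩ := Int.eq_ofNat_of_zero_le (show 0 ≤ k - 1 - y by omega)
  refine ⟨c, i, by omega, by omega, Prod.ext rfl (by dsimp only; omega), ?_⟩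
  simp only [cellNumber, hi]
  omega

theorem exists_cellNumber_eq_of_lt {c i : ℕ} (hc : c < n) (hi : i < k) :
    ∃ p : gridPoints k n, cellNumber p = k * c + i + 2 := by
  refine ⟨⟨((c : ℤ), (k : ℤ) - 1 - i), by refine ⟨?_, ?_, ?_, ?_⟩ <;> dsimp only <;> omega⟩, ?_⟩
  simp only [cellNumber, sub_sub_cancel]
  omega

theorem exists_cellNumber_eq_iff {x : ℕ} :
    (∃ p : gridPoints k n, cellNumber p = x) ↔ 2 ≤ x ∧ x < k * n + 2 := by
  constructor
  · rintro ⟨p, rfl⟩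
    obtain ⟨c, i, hc, hi, -, hp⟩ := exists_cellNumber_eq p
    have : k * (c + 1) ≤ k * n := Nat.mul_le_mul_left k hc
    rw [mul_add_one] at this
    omega
  · rintro ⟨hx, hxn⟩
    have hlt : x - 2 < k * n := by omega
    have hk : 0 < k := Nat.pos_of_mul_pos_right (Nat.zero_lt_of_lt hlt)
    obtain ⟨p, hp⟩ := exists_cellNumber_eq_of_lt (Nat.div_lt_of_lt_mul hlt) (Nat.mod_lt (x - 2) hk)
    exact ⟨p, by rw [hp, Nat.div_add_mod, Nat.sub_add_cancel hx]⟩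

theorem cellNumber_injective : (cellNumber : gridPoints k n → ℕ).Injective := by
  intro p q h
  obtain ⟨c, i, -, hi, hp, hpc⟩ := exists_cellNumber_eq p
  obtain ⟨d, j, -, hj, hq, hqc⟩ := exists_cellNumber_eq q
  rw [hpc, hqc, Nat.add_right_cancel_iff, mul_add_inj hi hj] at h
  exact Subtype.ext (by rw [hp, hq, h.1, h.2])

theorem succ_cell_iff {c d i j : ℕ} (hi : i < k) (hj : j < k) :
    k * d + j + 2 = k * c + i + 2 + 1 ∧ ¬ k ∣ k * c + i + 2 - 1 ↔ d = c ∧ j = i + 1 := by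
  have hdvd : k ∣ k * c + i + 2 - 1 ↔ i + 1 = k := by
    rw [show k * c + i + 2 - 1 = k * c + (i + 1) by omega, Nat.dvd_add_right (dvd_mul_right k c)]
    exact ⟨fun h => (Nat.le_of_dvd i.succ_pos h).antisymm' hi, fun h => h ▸ dvd_rfl⟩
  rw [hdvd]
  constructor
  · rintro ⟨h, hik⟩
    exact (mul_add_inj hj (by omega : i + 1 < k)).1 (by omega)
  · rintro ⟨rfl, rfl⟩
    omega

theorem stripGraph_adj_cell {c d i j : ℕ} (hi : i < k) (hj : j < k) :
    (stripGraph k).Adj (k * c + i + 2) (k * d + j + 2) ↔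
      c = d ∧ (i = j + 1 ∨ j = i + 1) ∨ i = j ∧ (c = d + 1 ∨ d = c + 1) := by
  have hcell := mul_add_inj (c := c) (c' := d) hi hj
  have hnext := mul_add_inj (c := d) (c' := c + 1) hj hi
  have hprev := mul_add_inj (c := c) (c' := d + 1) hi hj
  rw [mul_add_one] at hnext hprev
  rw [stripGraph_adj, succ_cell_iff hi hj, succ_cell_iff hj hi]
  omega

theorem sq_add_sq_eq_one_iff {a b : ℤ} :
    a ^ 2 + b ^ 2 = 1 ↔ a = 0 ∧ (b = 1 ∨ b = -1) ∨ b = 0 ∧ (a = 1 ∨ a = -1) := by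
  constructor
  · intro h
    have ha : a ≤ 1 := by nlinarith [sq_nonneg b]
    have ha' : -1 ≤ a := by nlinarith [sq_nonneg b]
    interval_cases a <;> simpa using h
  · rintro (⟨rfl, rfl | rfl⟩ | ⟨rfl, rfl | rfl⟩) <;> norm_num

theorem adj_cellNumber_iff (p q : gridPoints k n) :
    (stripGraph k).Adj (cellNumber p) (cellNumber q) ↔ (gridGraph (gridPoints k n)).Adj p q := by
  obtain ⟨c, i, -, hi, hp, hpc⟩ := exists_cellNumber_eq p
  obtain ⟨d, j, -, hj, hq, hqc⟩ := exists_cellNumber_eq q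
  rw [hpc, hqc, stripGraph_adj_cell hi hj]
  change _ ↔ (p.1.1 - q.1.1) ^ 2 + (p.1.2 - q.1.2) ^ 2 = 1
  rw [sq_add_sq_eq_one_iff, hp, hq]
  omega

theorem cellNumber_eq_two_iff (p : gridPoints k n) :
    cellNumber p = 2 ↔ (p : ℤ × ℤ) = (0, (k : ℤ) - 1) := by
  obtain ⟨c, i, -, hi, hp, hpc⟩ := exists_cellNumber_eq p
  have h := mul_add_inj (c := c) (c' := 0) hi (Nat.zero_lt_of_lt hi)
  rw [hpc, hp, Prod.mk.injEq]
  omega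

theorem isGreekKeyTour_iff (hk : 0 < k) (hn : 0 < n) (w : List (gridPoints k n)) :
    IsGreekKeyTour k n w ↔ IsStripTour k (k * n + 2) (w.map cellNumber) := by
  have hchain : (w.map cellNumber).IsChain (stripGraph k).Adj ↔
      w.IsChain (gridGraph (gridPoints k n)).Adj := by
    rw [List.isChain_map]
    simp only [adj_cellNumber_iff]
  constructor
  · rintro ⟨⟨hadj, hnodup, -⟩, hhead, hall⟩
    refine ⟨hnodup.map cellNumber_injective, fun x => ?_, hchain.2 hadj, ?_⟩
    · simp [← exists_cellNumber_eq_iff, hall]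
    · obtain ⟨p, -⟩ := exists_cellNumber_eq_of_lt hn hk
      obtain ⟨a, t, rfl⟩ := List.exists_cons_of_ne_nil (List.ne_nil_of_mem (hall p))
      exact congrArg some ((cellNumber_eq_two_iff a).2 (hhead a rfl))
  · intro h
    have hall (p : gridPoints k n) : p ∈ w := by
      rw [← List.mem_map_of_injective cellNumber_injective, h.mem_iff, ← exists_cellNumber_eq_iff]
      exact ⟨p, rfl⟩
    refine ⟨⟨hchain.1 h.isChain, h.nodup.of_map, fun _ _ p _ => hall p⟩, fun p hp => ?_, hall⟩
    rw [← cellNumber_eq_two_iff]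
    simpa [Option.mem_def.1 hp] using h.head_eq

theorem greekKeyCount_eq_stripCount (hk : 0 < k) (hn : 0 < n) :
    greekKeyCount k n = stripCount k 2 (k * n + 2) {s(0, 2)} := by
  rw [← ncard_isStripTour]
  refine Set.ncard_congr (fun w _ => w.map cellNumber)
    (fun w hw => (isGreekKeyTour_iff hk hn w).1 hw)
    (fun _ _ _ _ h => cellNumber_injective.list_map h) fun l hl => ?_
  have hrange : l ∈ Set.range (List.map (cellNumber : gridPoints k n → ℕ)) := by
    rw [Set.range_list_map]
    exact fun x hx => exists_cellNumber_eq_iff.2 ((hl.mem_iff x).1 hx)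
  obtain ⟨w, rfl⟩ := hrange
  exact ⟨w, (isGreekKeyTour_iff hk hn w).2 hl, rfl⟩

theorem greekKeyCount_zero (k : ℕ) : greekKeyCount k 0 = 1 := by
  have : IsEmpty (gridPoints k 0) := ⟨fun ⟨_, hx, hxn, _⟩ => (hx.trans_lt hxn).ne rfl⟩
  have htours : {w | IsGreekKeyTour k 0 w} = {[]} := by
    ext w
    rw [Subsingleton.elim w []]
    simp [IsGreekKeyTour, IsGSAW]
  rw [greekKeyCount, htours, Set.ncard_singleton]

end Grid

section Transfer

/-- Classes of sets of links between the cells `2`, …, `6` of the first column and the two ends, and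
for every class the classes, with multiplicity, of the translates of the sets that arise from any of
its members when the column is eliminated. The list contains every set that can be reached from
`{s(0, 2)}`; the classes were found by partition refinement, starting from the distinction between
`{s(0, 1)}`, which is the class `0`, and the other sets. -/
def linkClasses : List (List (Finset (Sym2 ℕ)) × List ℕ) :=
  [([{s(0, 1)}], []),
   ([{s(0, 2)}, {s(0, 6)}], [0, 1, 2, 2, 2, 3, 3, 3, 4, 4, 4, 5, 6, 6, 6, 7, 8, 9, 10, 11, 12]),
   ([{s(0, 2), s(1, 3)}, {s(0, 2), s(1, 3), s(5, 6)}, {s(0, 3), s(1, 2)},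
      {s(0, 3), s(1, 2), s(5, 6)}, {s(0, 5), s(1, 6)}, {s(0, 5), s(1, 6), s(2, 3)},
      {s(0, 6), s(1, 5)}, {s(0, 6), s(1, 5), s(2, 3)}], [3, 3, 8]),
   ([{s(0, 2), s(1, 3), s(4, 6)}, {s(0, 2), s(1, 4)}, {s(0, 2), s(1, 4), s(5, 6)},
      {s(0, 3), s(1, 2), s(4, 6)}, {s(0, 4), s(1, 2)}, {s(0, 4), s(1, 2), s(5, 6)},
      {s(0, 4), s(1, 6)}, {s(0, 4), s(1, 6), s(2, 3)}, {s(0, 5), s(1, 6), s(2, 4)},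
      {s(0, 6), s(1, 4)}, {s(0, 6), s(1, 4), s(2, 3)}, {s(0, 6), s(1, 5), s(2, 4)}], [2, 4, 6]),
   ([{s(0, 2), s(1, 3), s(4, 5)}, {s(0, 3), s(1, 2), s(4, 5)}, {s(0, 3), s(1, 4)},
      {s(0, 3), s(1, 4), s(5, 6)}, {s(0, 4), s(1, 3)}, {s(0, 4), s(1, 3), s(5, 6)},
      {s(0, 4), s(1, 5)}, {s(0, 4), s(1, 5), s(2, 3)}, {s(0, 5), s(1, 4)},
      {s(0, 5), s(1, 4), s(2, 3)}, {s(0, 5), s(1, 6), s(3, 4)}, {s(0, 6), s(1, 5), s(3, 4)}],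
      [3, 8]),
   ([{s(0, 4), s(2, 3)}, {s(0, 4), s(5, 6)}], [2, 3, 3, 4, 4, 6, 6, 8, 8, 13, 13, 14]),
   ([{s(0, 2), s(1, 5)}, {s(0, 2), s(1, 5), s(3, 4)}, {s(0, 3), s(1, 6)},
      {s(0, 3), s(1, 6), s(4, 5)}, {s(0, 5), s(1, 2)}, {s(0, 5), s(1, 2), s(3, 4)},
      {s(0, 6), s(1, 3)}, {s(0, 6), s(1, 3), s(4, 5)}], [3, 11]),
   ([{s(0, 3), s(4, 6)}, {s(0, 5), s(2, 4)}], [2, 3, 4, 6, 6, 6, 8, 13, 15, 16]),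
   ([{s(0, 2), s(1, 6)}, {s(0, 6), s(1, 2)}], [0, 2, 2, 4, 4, 6, 6, 10]),
   ([{s(0, 2), s(3, 6)}, {s(0, 6), s(2, 5)}],
      [0, 2, 2, 3, 3, 3, 4, 4, 6, 6, 8, 11, 13, 15, 15, 16, 17, 18, 18, 19, 20, 21]),
   ([{s(0, 2), s(1, 6), s(3, 5)}, {s(0, 6), s(1, 2), s(3, 5)}], [3, 3, 11, 11]),
   ([{s(0, 2), s(1, 6), s(3, 4)}, {s(0, 2), s(1, 6), s(4, 5)}, {s(0, 6), s(1, 2), s(3, 4)},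
      {s(0, 6), s(1, 2), s(4, 5)}], [0, 2, 2, 4, 6, 10]),
   ([{s(0, 2), s(3, 4), s(5, 6)}, {s(0, 6), s(2, 3), s(4, 5)}],
      [0, 1, 2, 2, 3, 3, 4, 5, 6, 8, 9, 11, 12]),
   ([{s(0, 2), s(5, 6)}, {s(0, 6), s(2, 3)}],
      [0, 1, 2, 2, 3, 3, 3, 4, 4, 4, 5, 6, 6, 7, 8, 9, 11, 12]),
   ([{s(0, 4), s(2, 3), s(5, 6)}], [3, 3, 4, 4, 6, 6, 8, 8, 13, 13, 14]),
   ([{s(0, 2), s(1, 4), s(3, 6)}, {s(0, 2), s(1, 5), s(4, 6)}, {s(0, 6), s(1, 3), s(2, 4)},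
      {s(0, 6), s(1, 4), s(2, 5)}], [0, 2, 2, 4, 6, 19, 20]),
   ([{s(0, 2), s(4, 5)}, {s(0, 6), s(3, 4)}], [0, 1, 2, 2, 3, 4, 6, 6, 7, 8, 9, 10]),
   ([{s(0, 4)}], [2, 2, 3, 3, 4, 4, 6, 6, 8, 8, 13, 13, 14]),
   ([{s(0, 2), s(3, 4)}, {s(0, 6), s(4, 5)}], [0, 1, 2, 2, 2, 3, 3, 4, 5, 6, 8, 9, 10, 11, 12]),
   ([{s(0, 2), s(1, 5), s(3, 6)}, {s(0, 6), s(1, 3), s(2, 5)}], [3, 3, 8, 15, 15]),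
   ([{s(0, 2), s(1, 4), s(3, 5)}, {s(0, 3), s(1, 5), s(4, 6)}, {s(0, 5), s(1, 3), s(2, 4)},
      {s(0, 6), s(1, 4), s(3, 5)}], [3, 8, 15]),
   ([{s(0, 2), s(3, 6), s(4, 5)}, {s(0, 6), s(2, 5), s(3, 4)}],
      [0, 2, 2, 3, 3, 4, 6, 8, 11, 13, 15, 17, 18, 18, 19, 21])]

/-- The members of the class `c`. -/
def linkClass (c : ℕ) : List (Finset (Sym2 ℕ)) := (linkClasses.getD c ([], [])).1

/-- The classes to which the elimination of a column leads from the class `c`. -/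
def classRow (c : ℕ) : List ℕ := (linkClasses.getD c ([], [])).2

/-- The class of the set of links that is translated by one column to `M`. It is the length of
`linkClasses` if there is none. -/
def shiftedClass (M : Finset (Sym2 ℕ)) : ℕ :=
  linkClasses.findIdx fun C => ∃ M' ∈ C.1, M = M'.map (stripShift 5).toEmbedding.sym2Map

/-- The number of ways to complete a set of links in the class `c` on `n` columns. -/
def completions : ℕ → ℕ → ℕ
  | 0, c => if c = 0 then 1 else 0
  | n + 1, c => ((classRow c).map (completions n)).sum

variable {c d n : ℕ} {M : Finset (Sym2 ℕ)}

theorem getD_linkClasses_mem (hc : c < linkClasses.length) :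
    linkClasses.getD c ([], []) ∈ linkClasses := by
  rw [List.getD_eq_getElem _ _ hc]
  exact List.getElem_mem hc

theorem lt_length_of_mem_linkClass (hM : M ∈ linkClass c) : c < linkClasses.length := by
  by_contra! hc
  rw [linkClass, List.getD_eq_default _ _ hc] at hM
  exact List.not_mem_nil hM

theorem classRow_of_length_le (hc : linkClasses.length ≤ c) : classRow c = [] := by
  rw [classRow, List.getD_eq_default _ _ hc]

set_option maxRecDepth 10000 in
theorem map_shiftedClass_sweep (hM : M ∈ linkClass c) :
    (sweep 5 5 2 M).map shiftedClass = classRow c := by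
  have h : ∀ C ∈ linkClasses, ∀ M ∈ C.1, (sweep 5 5 2 M).map shiftedClass = C.2 := by
    decide +kernel
  exact h _ (getD_linkClasses_mem (lt_length_of_mem_linkClass hM)) M hM

theorem lt_length_of_mem_classRow (hd : d ∈ classRow c) : d < linkClasses.length := by
  have h : ∀ C ∈ linkClasses, ∀ d ∈ C.2, d < linkClasses.length := by decide +kernel
  by_cases hc : c < linkClasses.length
  · exact h _ (getD_linkClasses_mem hc) d hd
  · rw [classRow_of_length_le (not_lt.1 hc)] at hd
    exact absurd hd List.not_mem_nil

theorem eq_singleton_iff_of_mem_linkClass (hM : M ∈ linkClass c) : M = {s(0, 1)} ↔ c = 0 := by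
  have h : ∀ c < linkClasses.length, ∀ M ∈ linkClass c, M = {s(0, 1)} ↔ c = 0 := by
    decide +kernel
  exact h c (lt_length_of_mem_linkClass hM) M hM

theorem exists_mem_linkClass_shiftedClass (hM : shiftedClass M < linkClasses.length) :
    ∃ M' ∈ linkClass (shiftedClass M), M = M'.map (stripShift 5).toEmbedding.sym2Map := by
  rw [linkClass, List.getD_eq_getElem _ _ hM]
  exact of_decide_eq_true (List.findIdx_getElem (w := hM))

theorem stripCount_eq_completions (hM : M ∈ linkClass c) :
    stripCount 5 2 (5 * n + 2) M = completions n c := by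
  induction n generalizing c M with
  | zero =>
    rw [Nat.mul_zero, Nat.zero_add, stripCount_self, completions]
    simp only [eq_singleton_iff_of_mem_linkClass hM]
  | succ n ih =>
    have hrow := map_shiftedClass_sweep hM
    rw [stripCount_eq_sum_sweep le_rfl 5 (by omega), completions, ← Multiset.sum_coe,
      ← Multiset.map_coe, ← hrow, Multiset.map_map]
    refine congrArg Multiset.sum (Multiset.map_congr rfl fun M₁ hM₁ => ?_)
    have hclass : shiftedClass M₁ ∈ classRow c := by
      rw [← Multiset.mem_coe, ← hrow]
      exact Multiset.mem_map_of_mem _ hM₁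
    obtain ⟨M₂, hM₂, hshift⟩ :=
      exists_mem_linkClass_shiftedClass (lt_length_of_mem_classRow hclass)
    rw [Function.comp_apply, ← ih hM₂, ← stripCount_map_stripShift le_rfl, ← hshift,
      Nat.mul_add_one, Nat.add_right_comm]

theorem greekKeyCount_eq_completions (hn : 0 < n) : greekKeyCount 5 n = completions n 1 := by
  rw [greekKeyCount_eq_stripCount (by norm_num) hn]
  exact stripCount_eq_completions (by decide +kernel)

end Transfer

section Recurrence

theorem isSolution_of_transfer {R ι : Type*} [CommSemiring R] (E : LinearRecurrence R)
    {a : ι → ℕ → R} (row : ι → List ι)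
    (hstep : ∀ c n, a c (n + 1) = ((row c).map (a · n)).sum)
    (hbase : ∀ c, a c E.order = ∑ i, E.coeffs i * a c i) (c : ι) : E.IsSolution (a c) := by
  intro n
  induction n generalizing c with
  | zero => simpa only [zero_add] using hbase c
  | succ n ih =>
    simp only [Nat.add_right_comm n 1, hstep, ih]
    induction row c with
    | nil => simp
    | cons d r ihr => simp only [List.map_cons, List.sum_cons, ihr, mul_add, Finset.sum_add_distrib]

/-- The linear recurrence whose characteristic polynomial is the reciprocal of the denominator of
the generating function. -/
def greekKeyRecurrence : LinearRecurrence ℤ where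
  order := 13
  coeffs := ![-2, 0, -14, 0, 9, -6, -84, 2, 117, -33, -54, 14, 4]

theorem isSolution_completions (c : ℕ) :
    greekKeyRecurrence.IsSolution fun n => (completions (n + 2) c : ℤ) := by
  refine isSolution_of_transfer _ (a := fun c n => (completions (n + 2) c : ℤ)) classRow
    (fun c n => ?_) (fun c => ?_) c
  · rw [completions, Nat.cast_list_sum, List.map_map]
    rfl
  · by_cases hc : c < linkClasses.length
    · revert c
      decide +kernel
    · simp [completions, classRow_of_length_le (not_lt.1 hc)]

theorem isSolution_greekKeyCount :
    greekKeyRecurrence.IsSolution fun n => (greekKeyCount 5 (n + 2) : ℤ) := by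
  simpa only [greekKeyCount_eq_completions (Nat.succ_pos _)] using isSolution_completions 1

theorem greekKeyCount_eq_of_fifteen_le {n : ℕ} (hn : 15 ≤ n) :
    (greekKeyCount 5 n : ℤ) =
      4 * greekKeyCount 5 (n - 1) + 14 * greekKeyCount 5 (n - 2)
      - 54 * greekKeyCount 5 (n - 3) - 33 * greekKeyCount 5 (n - 4)
      + 117 * greekKeyCount 5 (n - 5) + 2 * greekKeyCount 5 (n - 6)
      - 84 * greekKeyCount 5 (n - 7) - 6 * greekKeyCount 5 (n - 8)
      + 9 * greekKeyCount 5 (n - 9) - 14 * greekKeyCount 5 (n - 11)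
      - 2 * greekKeyCount 5 (n - 13) := by
  obtain ⟨m, rfl⟩ := Nat.exists_eq_add_of_le' hn
  have h : (greekKeyCount 5 (m + 13 + 2) : ℤ) =
      ∑ i : Fin 13, greekKeyRecurrence.coeffs i * greekKeyCount 5 (m + i + 2) :=
    isSolution_greekKeyCount m
  simp only [greekKeyRecurrence, Fin.sum_univ_succ, Matrix.cons_val_zero, Matrix.cons_val_succ,
    Matrix.cons_val_fin_one, Fin.coe_ofNat_eq_mod, Nat.zero_mod, Fin.val_succ, Fin.val_eq_zero,
    Finset.univ_unique, Fin.default_eq_zero, Finset.sum_singleton, add_assoc, Nat.reduceAdd] at h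
  simp only [Nat.add_sub_assoc, Nat.reduceLeDiff, Nat.reduceSub]
  linarith

theorem greekKeyCount_eq_getD {n : ℕ} (hn : n < 15) : greekKeyCount 5 n =
    [1, 1, 5, 38, 160, 824, 3501, 16262, 68591, 304177, 1276805, 5522791, 23117164, 98562435,
      411870513].getD n 0 := by
  rcases n.eq_zero_or_pos with rfl | hpos
  · exact greekKeyCount_zero 5
  · rw [greekKeyCount_eq_completions hpos]
    revert n
    decide +kernel

end Recurrence

section GeneratingFunction

open PowerSeries

theorem coeff_greekKeySeries_mul_X_pow (k m n : ℕ) :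
    coeff n (greekKeySeries k * X ^ m) = if m ≤ n then (greekKeyCount k (n - m) : ℚ) else 0 := by
  rw [coeff_mul_X_pow', greekKeySeries, coeff_mk]

theorem greekKeySeries_mul_denominator :
    greekKeySeries 5 * ((1 + X) * (1 - 11 * X ^ 2 - 2 * X ^ 6) *
      (1 - 5 * X + 2 * X ^ 2 + 8 * X ^ 3 - 8 * X ^ 4 + X ^ 5 - X ^ 6)) =
    1 - 3 * X - 13 * X ^ 2 + 58 * X ^ 3 + 25 * X ^ 4 - 162 * X ^ 5 + 63 * X ^ 6 + 113 * X ^ 7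
      - 61 * X ^ 8 + 12 * X ^ 9 - 11 * X ^ 10 + 25 * X ^ 11 - 17 * X ^ 12 + 5 * X ^ 13
      - 3 * X ^ 14 := by
  set G := greekKeySeries 5 with hG
  have hproduct : G * ((1 + X) * (1 - 11 * X ^ 2 - 2 * X ^ 6) *
      (1 - 5 * X + 2 * X ^ 2 + 8 * X ^ 3 - 8 * X ^ 4 + X ^ 5 - X ^ 6)) =
      G * X ^ 0 - C 4 * (G * X ^ 1) - C 14 * (G * X ^ 2) + C 54 * (G * X ^ 3) + C 33 * (G * X ^ 4)
      - C 117 * (G * X ^ 5) - C 2 * (G * X ^ 6) + C 84 * (G * X ^ 7) + C 6 * (G * X ^ 8)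
      - C 9 * (G * X ^ 9) + C 14 * (G * X ^ 11) + C 2 * (G * X ^ 13) := by
    simp only [map_ofNat]
    ring
  rw [hproduct]
  simp only [← map_ofNat (C (R := ℚ))]
  ext n
  simp only [map_add, map_sub, coeff_C_mul, hG, coeff_greekKeySeries_mul_X_pow, coeff_X_pow,
    coeff_X, coeff_one]
  by_cases hn : 15 ≤ n
  · have hrec := congrArg (Int.cast : ℤ → ℚ) (greekKeyCount_eq_of_fifteen_le hn)
    push_cast at hrec
    have hle : ∀ k ≤ 15, k ≤ n := fun k hk => hk.trans hn
    have hne : ∀ k < 15, n ≠ k := fun k hk => (hk.trans_le hn).ne'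
    simp only [hle, hne, Nat.reduceLeDiff, Nat.reduceLT, if_true, if_false, Nat.sub_zero, hrec]
    ring
  · interval_cases n <;> norm_num [greekKeyCount_eq_getD]

end GeneratingFunction

theorem mainTheorem8 :
    greekKeySeries 5 =
      (1 - 3 * PowerSeries.X - 13 * PowerSeries.X ^ 2 + 58 * PowerSeries.X ^ 3
        + 25 * PowerSeries.X ^ 4 - 162 * PowerSeries.X ^ 5 + 63 * PowerSeries.X ^ 6
        + 113 * PowerSeries.X ^ 7 - 61 * PowerSeries.X ^ 8 + 12 * PowerSeries.X ^ 9
        - 11 * PowerSeries.X ^ 10 + 25 * PowerSeries.X ^ 11 - 17 * PowerSeries.X ^ 12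
        + 5 * PowerSeries.X ^ 13 - 3 * PowerSeries.X ^ 14) *
      ((1 + PowerSeries.X) * (1 - 11 * PowerSeries.X ^ 2 - 2 * PowerSeries.X ^ 6) *
        (1 - 5 * PowerSeries.X + 2 * PowerSeries.X ^ 2 + 8 * PowerSeries.X ^ 3
          - 8 * PowerSeries.X ^ 4 + PowerSeries.X ^ 5 - PowerSeries.X ^ 6))⁻¹ ∧
    (greekKeyCount 5 0 = 1 ∧ greekKeyCount 5 1 = 1 ∧ greekKeyCount 5 2 = 5 ∧
      greekKeyCount 5 3 = 38 ∧ greekKeyCount 5 4 = 160 ∧ greekKeyCount 5 5 = 824) ∧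
    ∀ n : ℕ, 15 ≤ n →
      (greekKeyCount 5 n : ℤ) =
        4 * greekKeyCount 5 (n - 1) + 14 * greekKeyCount 5 (n - 2)
        - 54 * greekKeyCount 5 (n - 3) - 33 * greekKeyCount 5 (n - 4)
        + 117 * greekKeyCount 5 (n - 5) + 2 * greekKeyCount 5 (n - 6)
        - 84 * greekKeyCount 5 (n - 7) - 6 * greekKeyCount 5 (n - 8)
        + 9 * greekKeyCount 5 (n - 9) - 14 * greekKeyCount 5 (n - 11)
        - 2 * greekKeyCount 5 (n - 13) := by
  refine ⟨?_, ⟨greekKeyCount_eq_getD (by norm_num), greekKeyCount_eq_getD (by norm_num),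
    greekKeyCount_eq_getD (by norm_num), greekKeyCount_eq_getD (by norm_num),
    greekKeyCount_eq_getD (by norm_num), greekKeyCount_eq_getD (by norm_num)⟩,
    fun n => greekKeyCount_eq_of_fifteen_le⟩
  rw [PowerSeries.eq_mul_inv_iff_mul_eq (by simp)]
  exact greekKeySeries_mul_denominator
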